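/- Let $K$ be a field and $H$ a finite-dimensional associative unital $K$-algebra for which $K$ is a splitting field (every simple right $H$-module $L$ has $\mathrm{End}_H(L)=K$). Let $\tau\colon H\to K$ be a linear form making $(H,\tau)$ a Frobenius algebra, i.e. such that $a\mapsto(b\mapsto\tau(ab))$ is bijective from $H$ onto its dual space, and let $\alpha$ be the Nakayama automorphism of $H$, the unique algebra automorphism with $\tau(ab)=\tau(\alpha(b)a)$ for all $a,b\in H$. Let $(B_w)_{w\in W}$ be any $K$-basis of $H$ and $(B_w^\vee)_{w\in W}$ its dual basis, determined by $\tau(B_y^\vee B_w)=\delta_{y,w}$. Modules are finite-dimensional right modules, and PIM means projective indecomposable module. Let $P$ be a PIM with socle $S=\mathrm{soc}(P)$, and let $(b_i)_{i=1}^{n}$, $n=m+d$, be a $K$-basis of $P$, with dual basis $(b_i^*)$ of $\mathrm{Hom}_K(P,K)$, which is adapted to socle and radical: $(b_i)_{i=1}^{d}$ is a basis of $S$, $(b_i)_{i=1}^{m}$ is a basis of $\mathrm{rad}(P)$, and $b_i^*(b_jh)=b_{m+i}^*(b_{m+j}\,\alpha(h))$ for all $h\in H$ and $1\le i,j\le d$.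 Put $$c:=c(1,1,1,1+m),\qquad c(i,j,s,t):=\sum_{w\in W} b_s^*(b_iB_w)\,b_j^*(b_tB_w^\vee).$$ Then $d\geq 1$ and $c\neq 0$, so for $1\le i\le d$ we may define $$\tilde e_i:=c^{-1}\sum_{w\in W}b_i^*(b_{i+m}B_w)\,B_w^\vee,\qquad \tilde E_i:=c^{-1}\sum_{w\in W}b_i^*(b_{i+m}B_w^\vee)\,B_w .$$ Moreover $\mathrm{rad}(H)$ is nilpotent, and for every integer $a\ge 0$ with $\mathrm{rad}(H)^a=0$ the polynomial $$f:=\sum_{s=0}^{a}\binom{2a}{s}X^{2a-s}(1-X)^s\in\mathbb Z[X]$$ has the following properties. 1. The elements $e_i:=f(\tilde e_i)$ satisfy $e_i^2=e_i$ and $e_iH\cong P$ for all $1\le i\le d$, and $e_ie_{i'}\in\mathrm{rad}(H)$ for $i\ne i'$. 2. The elements $E_i:=f(\tilde E_i)$ satisfy $E_i^2=E_i$ and $E_iH\cong\bar P$ for all $1\le i\le d$ and every PIM $\bar P$ whose head $\bar P/\mathrm{rad}(\bar P)$ is isomorphic to $S$, and $E_iE_{i'}\in\mathrm{rad}(H)$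 for $i\neq i'$. -/

import Mathlib

open scoped RightActions
open Polynomial

/-!
Right modules over `H` are modules over `Hᵐᵒᵖ`; the right action of `h` on `p` is written `p <• h`
(notation for `MulOpposite.op h • p`).
-/

namespace FrobPIM

section Modules

/-- The socle of a module: the sum of all its simple submodules. -/
def socle (R M : Type*) [Ring R] [AddCommGroup M] [Module R M] : Submodule R M :=
  sSup {N : Submodule R M | IsSimpleModule R N}

/-- The head `M / rad M` of a module, where `rad M` is the intersection of the maximal
submodules. -/
abbrev Head (R M : Type*) [Ring R] [AddCommGroup M] [Module R M] : Type _ :=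
  M ⧸ Module.jacobson R M

/-- A projective indecomposable module (PIM), in the category of finitely generated modules. -/
structure IsPIM (R M : Type*) [Ring R] [AddCommGroup M] [Module R M] : Prop where
  finite : Module.Finite R M
  projective : Module.Projective R M
  nontrivial : Nontrivial M
  indecomposable : ∀ N N' : Submodule R M, IsCompl N N' → N = ⊥ ∨ N' = ⊥

/-- `K` is a splitting field for the `K`-algebra `H`: the only endomorphisms of a simple right
`H`-module are the scalars. (Every simple right module is a quotient of `H`, so it has an isomorphic
copy in the universe of `H`.) -/
def IsSplittingFieldFor.{v, u} (K : Type v) (H : Type u) [Field K] [Ring H] [Algebra K H] : Prop :=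
  ∀ (L : Type u) [AddCommGroup L] [Module Hᵐᵒᵖ L], IsSimpleModule Hᵐᵒᵖ L →
    ∀ g : L →ₗ[Hᵐᵒᵖ] L, ∃ k : K, ∀ x : L, g x = x <• algebraMap K H k

end Modules

section Frobenius

variable {K H : Type*} [Field K] [Ring H] [Algebra K H]

/-- The map `φ : H → H*`, `a ↦ (b ↦ τ (a b))`. -/
def toDual (τ : H →ₗ[K] K) : H →ₗ[K] Module.Dual K H :=
  (LinearMap.mul K H).compr₂ τ

@[simp] theorem toDual_apply (τ : H →ₗ[K] K) (a b : H) : toDual τ a b = τ (a * b) := rfl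

/-- `(H, τ)` is a Frobenius algebra (for finite-dimensional `H`): `a ↦ (b ↦ τ (a b))` is an
isomorphism onto the dual space. It is automatically compatible with the module structures:
`φ (a * h) b = φ a (h * b)`. -/
def IsFrobenius (τ : H →ₗ[K] K) : Prop :=
  Function.Bijective (toDual τ)

/-- `φ` as a linear equivalence. -/
noncomputable def toDualEquiv {τ : H →ₗ[K] K} (hτ : IsFrobenius τ) : H ≃ₗ[K] Module.Dual K H :=
  LinearEquiv.ofBijective (toDual τ) hτ

theorem tau_toDualEquiv_symm_mul {τ : H →ₗ[K] K} (hτ : IsFrobenius τ) (g : Module.Dual K H)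
    (b : H) : τ ((toDualEquiv hτ).symm g * b) = g b := by
  have h : toDualEquiv hτ ((toDualEquiv hτ).symm g) = g := LinearEquiv.apply_symm_apply _ _
  exact LinearMap.congr_fun h b

theorem ext_left {τ : H →ₗ[K] K} (hτ : IsFrobenius τ) {x y : H}
    (h : ∀ b, τ (x * b) = τ (y * b)) : x = y :=
  hτ.1 (LinearMap.ext h)

/-- The dual family `(B_w^∨)` of a basis `(B_w)`, determined by `τ (B_y^∨ * B_w) = δ_{y,w}`. -/
noncomputable def dualBasis {τ : H →ₗ[K] K} (hτ : IsFrobenius τ) {W : Type*}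
    (B : Module.Basis W K H) (y : W) : H :=
  (toDualEquiv hτ).symm (B.coord y)

theorem tau_dualBasis_mul {τ : H →ₗ[K] K} (hτ : IsFrobenius τ) {W : Type*} [DecidableEq W]
    (B : Module.Basis W K H) (y w : W) : τ (dualBasis hτ B y * B w) = if y = w then 1 else 0 := by
  rw [dualBasis, tau_toDualEquiv_symm_mul, Module.Basis.coord_apply, Module.Basis.repr_self,
    Finsupp.single_apply]
  simp only [eq_comm]

/-- The linear map `α` underlying the Nakayama automorphism. -/
noncomputable def nakayamaLin {τ : H →ₗ[K] K} (hτ : IsFrobenius τ) : H →ₗ[K] H :=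
  (toDualEquiv hτ).symm.toLinearMap ∘ₗ (toDual τ).flip

theorem tau_nakayamaLin {τ : H →ₗ[K] K} (hτ : IsFrobenius τ) (a b : H) :
    τ (a * b) = τ (nakayamaLin hτ b * a) :=
  (tau_toDualEquiv_symm_mul hτ ((toDual τ).flip b) a).symm

theorem nakayamaLin_bijective [FiniteDimensional K H] {τ : H →ₗ[K] K} (hτ : IsFrobenius τ) :
    Function.Bijective (nakayamaLin hτ) := by
  have hinj : Function.Injective (nakayamaLin hτ) := by
    rw [injective_iff_map_eq_zero]
    intro b hb
    have h0 : ∀ a, τ (a * b) = 0 := fun a => by rw [tau_nakayamaLin hτ, hb, zero_mul, map_zero]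
    rw [← Module.forall_dual_apply_eq_zero_iff K]
    intro g
    obtain ⟨a, rfl⟩ := hτ.2 g
    exact h0 a
  exact ⟨hinj, LinearMap.injective_iff_surjective.1 hinj⟩

/-- The Nakayama automorphism `α` of a Frobenius algebra `(H, τ)`. -/
noncomputable def nakayama [FiniteDimensional K H] {τ : H →ₗ[K] K} (hτ : IsFrobenius τ) :
    H ≃ₐ[K] H :=
  AlgEquiv.ofLinearEquiv (LinearEquiv.ofBijective (nakayamaLin hτ) (nakayamaLin_bijective hτ))
    (ext_left hτ fun b => by
      have h := tau_nakayamaLin hτ b 1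
      rw [mul_one] at h
      rw [one_mul]
      exact h.symm)
    (fun x y => ext_left hτ fun a => by
      have h1 := tau_nakayamaLin hτ a (x * y)
      have h2 := tau_nakayamaLin hτ (a * x) y
      have h3 := tau_nakayamaLin hτ (nakayamaLin hτ y * a) x
      change τ (nakayamaLin hτ (x * y) * a) = τ (nakayamaLin hτ x * nakayamaLin hτ y * a)
      rw [← h1, ← mul_assoc, h2, ← mul_assoc, h3, mul_assoc])

theorem tau_nakayama [FiniteDimensional K H] {τ : H →ₗ[K] K} (hτ : IsFrobenius τ) (a b : H) :
    τ (a * b) = τ (nakayama hτ b * a) :=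
  tau_nakayamaLin hτ a b

/-- A `K`-basis `b` of `P`, indexed by `{0, …, m + d - 1}`, is adapted to socle and radical: its
first `d` vectors form a basis of the socle, its first `m` vectors form a basis of the radical, and
the matrix of `h` on the socle with respect to the first `d` vectors is the matrix of `α h` on the
head with respect to the last `d` vectors, `α` being the Nakayama automorphism. -/
structure IsAdaptedBasis [FiniteDimensional K H] {τ : H →ₗ[K] K} (hτ : IsFrobenius τ)
    {P : Type*} [AddCommGroup P] [Module K P] [Module Hᵐᵒᵖ P] [IsScalarTower K Hᵐᵒᵖ P]
    {m d : ℕ} (b : Module.Basis (Fin (m + d)) K P) : Prop where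
  socle_eq : Submodule.span K (Set.range fun i : Fin d => b (i.castLE (Nat.le_add_left d m))) =
    (socle Hᵐᵒᵖ P).restrictScalars K
  radical_eq : Submodule.span K (Set.range fun i : Fin m => b (i.castAdd d)) =
    (Module.jacobson Hᵐᵒᵖ P).restrictScalars K
  matrix_eq : ∀ (h : H) (i j : Fin d),
    b.coord (i.castLE (Nat.le_add_left d m)) (b (j.castLE (Nat.le_add_left d m)) <• h) =
      b.coord (i.natAdd m) (b (j.natAdd m) <• nakayama hτ h)

/-- The constants `c(i,j,s,t) = ∑_w b_s^*(b_i B_w) b_j^*(b_t B_w^∨)`. -/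
noncomputable def cconst {τ : H →ₗ[K] K} (hτ : IsFrobenius τ)
    {W : Type*} [Fintype W] (B : Module.Basis W K H)
    {P : Type*} [AddCommGroup P] [Module K P] [Module Hᵐᵒᵖ P]
    {n : ℕ} (b : Module.Basis (Fin n) K P) (i j s t : Fin n) : K :=
  ∑ w, b.coord s (b i <• B w) * b.coord j (b t <• dualBasis hτ B w)

/-- `ẽ = c⁻¹ ∑_w b_s^*(b_t B_w) B_w^∨`. -/
noncomputable def eTilde {τ : H →ₗ[K] K} (hτ : IsFrobenius τ)
    {W : Type*} [Fintype W] (B : Module.Basis W K H)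
    {P : Type*} [AddCommGroup P] [Module K P] [Module Hᵐᵒᵖ P]
    {n : ℕ} (b : Module.Basis (Fin n) K P) (c : K) (s t : Fin n) : H :=
  c⁻¹ • ∑ w, b.coord s (b t <• B w) • dualBasis hτ B w

/-- `Ẽ = c⁻¹ ∑_w b_s^*(b_t B_w^∨) B_w`. -/
noncomputable def ETilde {τ : H →ₗ[K] K} (hτ : IsFrobenius τ)
    {W : Type*} [Fintype W] (B : Module.Basis W K H)
    {P : Type*} [AddCommGroup P] [Module K P] [Module Hᵐᵒᵖ P]
    {n : ℕ} (b : Module.Basis (Fin n) K P) (c : K) (s t : Fin n) : H :=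
  c⁻¹ • ∑ w, b.coord s (b t <• dualBasis hτ B w) • B w

end Frobenius

/-- The polynomial `∑_{s=0}^{a} binom(2a, s) X^(2a-s) (1-X)^s` with integer coefficients. -/
noncomputable def idemPoly (a : ℕ) : ℤ[X] :=
  ∑ s ∈ Finset.range (a + 1), ((2 * a).choose s : ℤ[X]) * X ^ (2 * a - s) * (1 - X) ^ s

/-- The principal right ideal `e H`, as a right `H`-module. -/
abbrev rightIdeal {H : Type*} [Ring H] (e : H) : Submodule Hᵐᵒᵖ H :=
  Submodule.span Hᵐᵒᵖ {e}

theorem mem_rightIdeal {H : Type*} [Ring H] (e x : H) : x ∈ rightIdeal e ↔ ∃ h, x = e * h := by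
  rw [Submodule.mem_span_singleton]
  constructor
  · rintro ⟨h, rfl⟩
    exact ⟨h.unop, rfl⟩
  · rintro ⟨h, rfl⟩
    exact ⟨MulOpposite.op h, rfl⟩

end FrobPIM

/-!
A linear form `ξ` on `P` gives a homomorphism of right modules `Θ_ξ : P → H` with
`τ (Θ_ξ p * h) = ξ (p h)`, and every homomorphism `P → H` arises in this way (`frobHom`,
`exists_eq_frobHom`). With `Θ_i` attached to the coordinate form `b_i^*`, one has
`ẽ_i = c⁻¹ Θ_i(b_{m+i})`, and `Ẽ_i = α⁻¹(ẽ_i)` because interchanging a basis and its dual basis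
amounts to a twist by the Nakayama automorphism `α` (`sum_smul_dualBasis`, `sum_dualBasis_smul`).

The head of the PIM `P` is simple, and by the choice of the basis the socle is the head twisted by
`α`, hence simple too. So for `v` in `P` the endomorphism `p ↦ v Θ_i(p)` acts on the socle by a
scalar. The heart of the proof is `IsAdaptedBasis.exists_schur`: this scalar is `c b_{m+i}^*(v)`
with `c ≠ 0`. Indeed the scalars for the various `i` are the coordinates of a homomorphism from `P`
to its head, so Schur's lemma gives the shape of the formula, and the constant is nonzero because
`P` is projective. An endomorphism of `P` that kills part of the socle is not injective, so it maps
`P` into the radical. Hence the scalar on the socle is also the scalar on the head, which means that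
`ẽ_i` acts on the head of `P` as the `i`-th diagonal matrix unit
(`IsAdaptedBasis.smul_eTilde_sub_mem`).

On the simple modules other than the head of `P`, the image of `Θ_i` acts as zero. Consequently
`ẽ_i - ẽ_i²` and `ẽ_i ẽ_j`, for `i ≠ j`, annihilate all simple modules and lie in the radical
(`mem_jacobson_of_right_smul_mem`). As `f - f²` is divisible by `(X - X²)^a`, the elements `e_i` are
idempotent. Multiplication `x ↦ b_{m+i} x` maps `e_i H` onto `P`, and it is injective since `e_i H`
is also a quotient of `P` (`IsPIM.nonempty_rightIdeal_equiv`).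

The idempotent `E_i = α⁻¹(e_i)` is primitive because `e_i` is, and it fixes the vector `b_i` of the
socle. If the head of a PIM `Q` is isomorphic to the socle of `P`, a lift of `b_i` to `Q` therefore
gives a surjection `E_i H → Q`, which splits and so is an isomorphism
(`IsPIM.nonempty_rightIdeal_equiv_of_primitive`).
-/

namespace FrobPIM

/-! ### Projective indecomposable modules over artinian rings -/

section PIM

variable {R M : Type*} [Ring R] [AddCommGroup M] [Module R M]

/-- By Fitting's lemma, an endomorphism of a PIM over an artinian ring is nilpotent or surjective. -/
theorem IsPIM.isNilpotent_or_surjective [IsArtinianRing R] (hM : IsPIM R M)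
    (g : Module.End R M) : IsNilpotent g ∨ Function.Surjective g := by
  have := hM.finite
  obtain ⟨k, hk⟩ := Filter.eventually_atTop.1 g.eventually_isCompl_ker_pow_range_pow
  have hk1 := hk (k + 1) (Nat.le_succ k)
  rcases hM.indecomposable _ _ hk1 with h | h
  · right
    rw [h] at hk1
    have htop : LinearMap.range (g ^ (k + 1)) = ⊤ := by simpa using hk1.sup_eq_top
    intro y
    obtain ⟨x, hx⟩ := LinearMap.range_eq_top.1 htop y
    exact ⟨(g ^ k) x, by rw [← hx, pow_succ']; rfl⟩
  · exact Or.inl ⟨k + 1, LinearMap.range_eq_bot.1 h⟩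

/-- A PIM has only one maximal submodule: for two of them, projectivity would give an endomorphism
that is neither nilpotent nor surjective. -/
theorem IsPIM.isCoatom_unique [IsArtinianRing R] (hM : IsPIM R M) {N N' : Submodule R M}
    (hN : IsCoatom N) (hN' : IsCoatom N') : N = N' := by
  have := hM.projective
  by_contra hne
  have hsup : N' ⊔ N = ⊤ := by
    refine hN'.2 _ (lt_of_le_of_ne le_sup_left fun h => hne ?_)
    exact (hN.le_iff.1 (sup_eq_left.1 h.symm)).resolve_left hN'.1 |>.symm
  have hsurj : Function.Surjective (N.mkQ ∘ₗ N'.subtype) := by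
    intro y
    obtain ⟨x, rfl⟩ := N.mkQ_surjective y
    obtain ⟨u, hu, v, hv, rfl⟩ := Submodule.mem_sup.1 (hsup ▸ Submodule.mem_top : x ∈ N' ⊔ N)
    refine ⟨⟨u, hu⟩, ?_⟩
    simp [hv]
  obtain ⟨g, hg⟩ := Module.projective_lifting_property _ N.mkQ hsurj
  -- `g'` is congruent to the identity modulo `N`, so it is not nilpotent, but its values lie in `N'`.
  let g' : Module.End R M := N'.subtype ∘ₗ g
  have hg' : ∀ n x, N.mkQ ((g' ^ n) x) = N.mkQ x := by
    intro n
    induction n with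
    | zero => intro x; simp
    | succ n ih =>
      intro x
      rw [pow_succ', Module.End.mul_apply, ← ih x]
      exact LinearMap.congr_fun hg _
  rcases hM.isNilpotent_or_surjective g' with ⟨n, hn⟩ | h
  · refine hN.1 (eq_top_iff.2 fun x _ => ?_)
    have := hg' n x
    rw [hn, LinearMap.zero_apply, map_zero] at this
    exact (Submodule.Quotient.mk_eq_zero N).1 this.symm
  · refine hN'.1 (eq_top_iff.2 fun x _ => ?_)
    obtain ⟨y, rfl⟩ := h x
    exact (g y).2

theorem IsPIM.isCoatom_jacobson [IsArtinianRing R] (hM : IsPIM R M) :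
    IsCoatom (Module.jacobson R M) := by
  have := hM.finite
  have := hM.nontrivial
  obtain ⟨N, hN, -⟩ := (eq_top_or_exists_le_coatom (⊥ : Submodule R M)).resolve_left bot_ne_top
  have : Module.jacobson R M = N :=
    le_antisymm (sInf_le hN) (le_sInf fun N' hN' => (hM.isCoatom_unique hN hN').le)
  rwa [this]

theorem IsPIM.le_jacobson [IsArtinianRing R] (hM : IsPIM R M) {N : Submodule R M}
    (hN : N ≠ ⊤) : N ≤ Module.jacobson R M := by
  have := hM.finite
  obtain ⟨N', hN', hle⟩ := (eq_top_or_exists_le_coatom N).resolve_left hN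
  rwa [hM.isCoatom_unique hM.isCoatom_jacobson hN']

theorem IsPIM.isSimpleModule_head [IsArtinianRing R] (hM : IsPIM R M) :
    IsSimpleModule R (Head R M) :=
  isSimpleModule_iff_isCoatom.2 hM.isCoatom_jacobson

theorem IsPIM.eq_zero_or_eq_one_of_isIdempotentElem (hM : IsPIM R M) {g : Module.End R M}
    (hg : IsIdempotentElem g) : g = 0 ∨ g = 1 := by
  rcases hM.indecomposable _ _ (LinearMap.IsIdempotentElem.isCompl hg) with h | h
  · left; exact LinearMap.range_eq_bot.1 h
  · right
    ext x
    refine LinearMap.ker_eq_bot.1 h ?_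
    exact LinearMap.congr_fun hg x

/-- A noninjective endomorphism of a PIM maps into the radical. -/
theorem IsPIM.apply_mem_jacobson [IsArtinianRing R] (hM : IsPIM R M) {g : Module.End R M}
    {s : M} (hs : s ≠ 0) (hgs : g s = 0) (x : M) : g x ∈ Module.jacobson R M := by
  have := hM.finite
  refine hM.le_jacobson (N := LinearMap.range g) (fun h => hs ?_) ⟨x, rfl⟩
  have hinj := IsNoetherian.injective_of_surjective_endomorphism g (LinearMap.range_eq_top.1 h)
  exact hinj (by rw [hgs, map_zero])

end PIM

/-! ### The radical through simple right modules -/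

section Jacobson

/-- The Jacobson radical of `Hᵐᵒᵖ` contains every element that annihilates all simple right
modules. -/
theorem op_mem_jacobson_of_forall_isSimpleModule {H : Type*} [Ring H] {x : H}
    (hx : ∀ I : Ideal Hᵐᵒᵖ, I.IsMaximal → ∀ l : Hᵐᵒᵖ ⧸ I, l <• x = 0) :
    MulOpposite.op x ∈ Ring.jacobson Hᵐᵒᵖ := by
  rw [Ring.jacobson_eq_sInf_isMaximal, Submodule.mem_sInf]
  intro I hI
  have := hx I hI (Submodule.Quotient.mk 1)
  rw [← Submodule.Quotient.mk_smul, Submodule.Quotient.mk_eq_zero] at this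
  simpa using this

/-- The right radical is contained in the left radical. Quasi-regularity in `Hᵐᵒᵖ` provides right
inverses of the elements `1 + y x`; they are left inverses because `H` is Dedekind finite. -/
theorem mem_jacobson_of_op_mem {H : Type*} [Ring H] [IsDedekindFiniteMonoid H] {x : H}
    (hx : MulOpposite.op x ∈ Ring.jacobson Hᵐᵒᵖ) : x ∈ Ring.jacobson H := by
  rw [← Ideal.jacobson_bot, Ideal.mem_jacobson_iff]
  intro y
  have h : MulOpposite.op x * MulOpposite.op y ∈ Ring.jacobson Hᵐᵒᵖ :=
    Ideal.mul_mem_right _ _ hx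
  rw [← Ideal.jacobson_bot, Ideal.mem_jacobson_iff] at h
  obtain ⟨z, hz⟩ := h 1
  refine ⟨z.unop, ?_⟩
  rw [Ideal.mem_bot] at hz ⊢
  have h1 : (y * x + 1) * z.unop = 1 := by
    have := congrArg MulOpposite.unop hz
    simp at this
    rw [add_mul, one_mul]
    exact sub_eq_zero.1 this
  have h2 := mul_eq_one_comm.1 h1
  rw [mul_add, mul_one, ← mul_assoc] at h2
  exact sub_eq_zero.2 h2

theorem map_mem_jacobson {A B : Type*} [Ring A] [Ring B] (φ : A ≃+* B) {x : A}
    (hx : x ∈ Ring.jacobson A) : φ x ∈ Ring.jacobson B := by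
  have : RingHomSurjective (φ : A →+* B) := ⟨φ.surjective⟩
  exact Ring.le_comap_jacobson (φ : A →+* B) hx

end Jacobson

/-! ### Schur's lemma over a splitting field -/

section Splitting

/-- Schur's lemma over a splitting field, for simple modules in any universe. -/
theorem IsSplittingFieldFor.exists_smul {K H : Type*} [Field K] [Ring H] [Algebra K H]
    (hK : IsSplittingFieldFor K H) {L : Type*} [AddCommGroup L] [Module Hᵐᵒᵖ L]
    (hL : IsSimpleModule Hᵐᵒᵖ L) (g : L →ₗ[Hᵐᵒᵖ] L) :
    ∃ k : K, ∀ x : L, g x = x <• algebraMap K H k := by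
  obtain ⟨I, hI, ⟨φ⟩⟩ := isSimpleModule_iff_quot_maximal.1 hL
  have hs : IsSimpleModule Hᵐᵒᵖ (Hᵐᵒᵖ ⧸ I) := IsSimpleModule.congr φ.symm
  obtain ⟨k, hk⟩ := hK (Hᵐᵒᵖ ⧸ I) hs (φ.toLinearMap ∘ₗ g ∘ₗ φ.symm.toLinearMap)
  refine ⟨k, fun x => φ.injective ?_⟩
  have := hk (φ x)
  simpa using this

end Splitting

/-! ### The polynomial lifting idempotents -/

section Idem

open Finset

/-- The remaining half of the binomial expansion of `(X + (1 - X)) ^ (2 * a) = 1`. -/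
theorem one_sub_idemPoly (a : ℕ) : 1 - idemPoly a =
    ∑ s ∈ range a, ((2 * a).choose (a + 1 + s) : ℤ[X]) * X ^ (a - 1 - s) *
      (1 - X) ^ (a + 1 + s) := by
  have h : (1 : ℤ[X]) = ∑ s ∈ range (a + 1 + a), ((2 * a).choose s : ℤ[X]) * X ^ (2 * a - s) *
      (1 - X) ^ s := by
    have h := add_pow (1 - X : ℤ[X]) X (2 * a)
    rw [sub_add_cancel, one_pow] at h
    rw [show 2 * a + 1 = a + 1 + a by ring] at h
    refine h.trans ?_
    exact sum_congr rfl fun s _ => by ring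
  rw [idemPoly, sub_eq_iff_eq_add']
  conv_lhs => rw [h]
  rw [sum_range_add]
  refine congrArg _ (sum_congr rfl fun s _ => ?_)
  rw [show 2 * a - (a + 1 + s) = a - 1 - s by omega]

theorem X_pow_dvd_idemPoly (a : ℕ) : (X : ℤ[X]) ^ a ∣ idemPoly a := by
  refine dvd_sum fun s hs => ?_
  have : s ≤ a := Nat.lt_succ_iff.1 (mem_range.1 hs)
  refine Dvd.dvd.mul_right (Dvd.dvd.mul_left (pow_dvd_pow _ ?_) _) _
  omega

theorem one_sub_X_pow_dvd_one_sub_idemPoly (a : ℕ) :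
    (1 - X : ℤ[X]) ^ (a + 1) ∣ 1 - idemPoly a := by
  rw [one_sub_idemPoly]
  refine dvd_sum fun s _ => Dvd.dvd.mul_left (pow_dvd_pow _ ?_) _
  omega

/-- Lifting of idempotents: `f - f ^ 2` is divisible by `(X - X ^ 2) ^ a`. -/
theorem isIdempotentElem_aeval_idemPoly {A : Type*} [Ring A] {a : ℕ} {x : A}
    (hx : (x - x * x) ^ a = 0) : aeval x (idemPoly a) * aeval x (idemPoly a) =
      aeval x (idemPoly a) := by
  obtain ⟨g, hg⟩ := X_pow_dvd_idemPoly a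
  obtain ⟨h, hh⟩ := (pow_dvd_pow _ a.le_succ).trans (one_sub_X_pow_dvd_one_sub_idemPoly a)
  have key : idemPoly a - idemPoly a * idemPoly a = (X - X * X) ^ a * (g * h) := by
    calc _ = idemPoly a * (1 - idemPoly a) := by ring
      _ = X ^ a * g * ((1 - X) ^ a * h) := by rw [hh, ← hg]
      _ = (X * (1 - X)) ^ a * (g * h) := by rw [mul_pow]; ring
      _ = _ := by rw [mul_sub, mul_one]
  have := congrArg (aeval x) key
  simp only [map_sub, map_mul, map_pow, aeval_X, hx, zero_mul] at this
  exact (sub_eq_zero.1 this).symm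

theorem exists_idemPoly_eq_X_mul {a : ℕ} (ha : a ≠ 0) : ∃ g : ℤ[X], idemPoly a = X * g :=
  (dvd_pow_self X ha).trans (X_pow_dvd_idemPoly a)

theorem exists_idemPoly_sub_one_eq (a : ℕ) : ∃ g : ℤ[X], idemPoly a - 1 = (X - 1) * g := by
  obtain ⟨g, hg⟩ := (dvd_pow_self _ a.succ_ne_zero).trans (one_sub_X_pow_dvd_one_sub_idemPoly a)
  exact ⟨g, by rw [← neg_sub, hg]; ring⟩

end Idem

/-! ### Homomorphisms into a Frobenius algebra -/

section Hom

variable {K H : Type*} [Field K] [Ring H] [Algebra K H]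
variable {L : Type*} [AddCommGroup L] [Module Hᵐᵒᵖ L]

/-- The homomorphism of right modules `H → L`, `h ↦ l h`, attached to `l : L`. -/
def actHom (l : L) : H →ₗ[Hᵐᵒᵖ] L where
  toFun h := l <• h
  map_add' x y := by rw [MulOpposite.op_add, add_smul]
  map_smul' k x := by
    obtain ⟨k, rfl⟩ := MulOpposite.op_surjective k
    simp [mul_smul]

variable {P : Type*} [AddCommGroup P] [Module K P] [Module Hᵐᵒᵖ P] [IsScalarTower K Hᵐᵒᵖ P]

theorem right_smul_algebraMap (p : P) (k : K) : p <• algebraMap K H k = k • p := by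
  rw [← MulOpposite.algebraMap_apply, algebraMap_smul]

/-- The `K`-linear map `H → P`, `h ↦ p h`. -/
def actLin (K : Type*) [Field K] [Algebra K H] [Module K P] [IsScalarTower K Hᵐᵒᵖ P] (p : P) :
    H →ₗ[K] P where
  toFun h := p <• h
  map_add' x y := by rw [MulOpposite.op_add, add_smul]
  map_smul' k x := by rw [MulOpposite.op_smul, smul_assoc, RingHom.id_apply]

@[simp] theorem actLin_apply (p : P) (h : H) : actLin K p h = p <• h := rfl

/-- The homomorphism `Θ : P → H` of right modules attached to a linear form `ξ` on `P`,
characterised by `τ (Θ p * h) = ξ (p h)`. -/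
noncomputable def frobHom {τ : H →ₗ[K] K} (hτ : IsFrobenius τ) (ξ : Module.Dual K P) :
    P →ₗ[Hᵐᵒᵖ] H where
  toFun p := (toDualEquiv hτ).symm (ξ ∘ₗ actLin K p)
  map_add' x y := by
    rw [← map_add]
    congr 1
    ext h
    simp
  map_smul' k x := by
    obtain ⟨k, rfl⟩ := MulOpposite.op_surjective k
    refine ext_left hτ fun h => ?_
    rw [RingHom.id_apply, op_smul_eq_mul, mul_assoc, tau_toDualEquiv_symm_mul,
      tau_toDualEquiv_symm_mul]
    simp [mul_smul]

theorem tau_frobHom_mul {τ : H →ₗ[K] K} (hτ : IsFrobenius τ) (ξ : Module.Dual K P) (p : P)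
    (h : H) : τ (frobHom hτ ξ p * h) = ξ (p <• h) :=
  tau_toDualEquiv_symm_mul hτ _ h

theorem sum_smul_dualBasis {τ : H →ₗ[K] K} (hτ : IsFrobenius τ) {W : Type*} [Fintype W]
    (B : Module.Basis W K H) (ξ : Module.Dual K P) (p : P) :
    ∑ w, ξ (p <• B w) • dualBasis hτ B w = frobHom hτ ξ p := by
  classical
  refine hτ.1 (B.ext fun y => ?_)
  simp only [toDual_apply]
  rw [tau_frobHom_mul, Finset.sum_mul, map_sum]
  simp [tau_dualBasis_mul]

/-- Interchanging a basis and its dual basis amounts to a twist by the Nakayama automorphism. -/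
theorem sum_dualBasis_smul [FiniteDimensional K H] {τ : H →ₗ[K] K} (hτ : IsFrobenius τ)
    {W : Type*} [Fintype W] (B : Module.Basis W K H) (ξ : Module.Dual K P) (p : P) :
    ∑ w, ξ (p <• dualBasis hτ B w) • B w = (nakayama hτ).symm (frobHom hτ ξ p) := by
  classical
  set y := ∑ w, ξ (p <• dualBasis hτ B w) • B w with hy
  have h1 : ∀ w, τ (dualBasis hτ B w * y) = ξ (p <• dualBasis hτ B w) := by
    intro w
    rw [hy, Finset.mul_sum, map_sum]
    simp [tau_dualBasis_mul]
  have h2 : ∀ h, τ (h * y) = ξ (p <• h) := by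
    intro h
    have hexp : h = ∑ w, τ (h * B w) • dualBasis hτ B w := by
      refine hτ.1 (B.ext fun y => ?_)
      simp only [toDual_apply]
      rw [Finset.sum_mul, map_sum]
      simp [tau_dualBasis_mul]
    calc τ (h * y) = ∑ w, τ (h * B w) * τ (dualBasis hτ B w * y) := by
          conv_lhs => rw [hexp]
          simp [Finset.sum_mul]
      _ = (ξ ∘ₗ actLin K p) (∑ w, τ (h * B w) • dualBasis hτ B w) := by
          simp [h1]
      _ = _ := by rw [← hexp]; rfl
  rw [AlgEquiv.eq_symm_apply]
  refine ext_left hτ fun h => ?_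
  rw [← tau_nakayama, h2, tau_frobHom_mul]

/-- Every homomorphism `θ : P → H` of right modules comes from a linear form, namely `τ ∘ θ`. -/
theorem exists_eq_frobHom {τ : H →ₗ[K] K} (hτ : IsFrobenius τ) (θ : P →ₗ[Hᵐᵒᵖ] H) :
    ∃ ξ : Module.Dual K P, θ = frobHom hτ ξ := by
  have hθ : ∀ (p : P) (h : H), θ (p <• h) = θ p * h := fun p h => θ.map_smul (MulOpposite.op h) p
  let ξ : Module.Dual K P :=
    { toFun := fun p => τ (θ p)
      map_add' := fun x y => by rw [map_add, map_add]
      map_smul' := fun k x => by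
        rw [← right_smul_algebraMap (H := H), hθ, ← Algebra.commutes, ← Algebra.smul_def, map_smul,
          RingHom.id_apply] }
  refine ⟨ξ, LinearMap.ext fun p => ext_left hτ fun h => ?_⟩
  rw [tau_frobHom_mul, ← hθ]
  rfl

/-- By the dual basis lemma for projective modules, every `s` is a sum of elements `v Θ(s)`, since
each homomorphism `P → H` has the form `Θ`. -/
theorem exists_frobHom_right_smul_ne_zero {τ : H →ₗ[K] K} (hτ : IsFrobenius τ)
    [Module.Projective Hᵐᵒᵖ P] {s : P} (hs : s ≠ 0) :
    ∃ (ξ : Module.Dual K P) (v : P), v <• frobHom hτ ξ s ≠ 0 := by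
  obtain ⟨σ, hσ⟩ := Module.projective_def.1 ‹Module.Projective Hᵐᵒᵖ P›
  by_contra! h
  refine hs ?_
  rw [← hσ s, Finsupp.linearCombination_apply]
  refine Finset.sum_eq_zero fun v _ => ?_
  -- The coordinate of `σ` at `v`, read as a homomorphism of right modules `P → H`.
  let θ : P →ₗ[Hᵐᵒᵖ] H :=
    { toFun := fun p => (σ p v).unop
      map_add' := fun x y => by simp
      map_smul' := fun k x => by
        obtain ⟨k, rfl⟩ := MulOpposite.op_surjective k
        simp }
  obtain ⟨ξ, hξ⟩ := exists_eq_frobHom hτ θ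
  have := h ξ v
  rw [← hξ] at this
  exact this

/-- An element `θ p` with `θ : P → H` which maps `P` into its radical lies in the radical of `H`:
if the image of `θ` does not annihilate a simple module `L`, then `L` is a quotient of `P`, by a
maximal submodule, so that `x` annihilates it too. -/
theorem mem_jacobson_of_right_smul_mem [IsDedekindFiniteMonoid H]
    {P : Type*} [AddCommGroup P] [Module Hᵐᵒᵖ P]
    (θ : P →ₗ[Hᵐᵒᵖ] H) {x : H} (hx : x ∈ LinearMap.range θ)
    (hPx : ∀ v : P, v <• x ∈ Module.jacobson Hᵐᵒᵖ P) : x ∈ Ring.jacobson H := by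
  refine mem_jacobson_of_op_mem (op_mem_jacobson_of_forall_isSimpleModule fun I hI l => ?_)
  have hs : IsSimpleModule Hᵐᵒᵖ (Hᵐᵒᵖ ⧸ I) := isSimpleModule_iff_isCoatom.2 hI.out
  obtain ⟨p, rfl⟩ := hx
  by_cases h : ∀ l' : Hᵐᵒᵖ ⧸ I, actHom l' ∘ₗ θ = 0
  · exact LinearMap.congr_fun (h l) p
  · push Not at h
    obtain ⟨l', hl'⟩ := h
    have hsurj := LinearMap.surjective_of_ne_zero hl'
    obtain ⟨q, rfl⟩ := hsurj l
    have hker : Module.jacobson Hᵐᵒᵖ P ≤ LinearMap.ker (actHom l' ∘ₗ θ) :=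
      sInf_le (LinearMap.isCoatom_ker_of_surjective hsurj)
    rw [← map_smul]
    exact hker (hPx q)

end Hom

/-! ### Adapted bases and the Schur relations -/

section Adapted

variable {K H : Type*} [Field K] [Ring H] [Algebra K H] [FiniteDimensional K H]
  {τ : H →ₗ[K] K} {hτ : IsFrobenius τ}
  {P : Type*} [AddCommGroup P] [Module K P] [Module Hᵐᵒᵖ P] [IsScalarTower K Hᵐᵒᵖ P]
  {m d : ℕ} {b : Module.Basis (Fin (m + d)) K P}

/-- The position of the `i`-th basis vector of the socle in an adapted basis. -/
abbrev lo (m : ℕ) {d : ℕ} (i : Fin d) : Fin (m + d) := i.castLE (Nat.le_add_left d m)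

/-- The position of the `i`-th basis vector of a complement of the radical in an adapted basis. -/
abbrev hi (m : ℕ) {d : ℕ} (i : Fin d) : Fin (m + d) := i.natAdd m

theorem coord_hi_sum (x : Fin d → K) (i : Fin d) :
    b.coord (hi m i) (∑ j, x j • b (hi m j)) = x i := by
  simp [map_sum, Finsupp.single_apply]

theorem coord_lo_sum (x : Fin d → K) (i : Fin d) :
    b.coord (lo m i) (∑ j, x j • b (lo m j)) = x i := by
  simp [map_sum, Finsupp.single_apply]

theorem IsAdaptedBasis.mem_jacobson_iff (hb : IsAdaptedBasis hτ b) {v : P} :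
    v ∈ Module.jacobson Hᵐᵒᵖ P ↔ ∀ i, b.coord (hi m i) v = 0 := by
  rw [← Submodule.restrictScalars_mem K, ← hb.radical_eq, Submodule.mem_span_range_iff_exists_fun]
  constructor
  · rintro ⟨x, rfl⟩ i
    rw [map_sum]
    refine Finset.sum_eq_zero fun j _ => ?_
    have : Fin.castAdd d j ≠ hi m i := fun h => by
      have := congrArg Fin.val h
      simp at this
      omega
    simp [this]
  · intro h
    refine ⟨fun i => b.coord (Fin.castAdd d i) v, ?_⟩
    conv_rhs => rw [← b.sum_repr v, Fin.sum_univ_add]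
    refine (add_eq_left.2 (Finset.sum_eq_zero fun i _ => ?_)).symm
    rw [← b.coord_apply, h i, zero_smul]

theorem IsAdaptedBasis.sub_sum_mem_jacobson (hb : IsAdaptedBasis hτ b) (v : P) :
    v - ∑ i, b.coord (hi m i) v • b (hi m i) ∈ Module.jacobson Hᵐᵒᵖ P := by
  rw [hb.mem_jacobson_iff]
  intro i
  rw [map_sub, coord_hi_sum, sub_self]

theorem IsAdaptedBasis.eq_sum_of_mem_socle (hb : IsAdaptedBasis hτ b) {s : P}
    (hs : s ∈ socle Hᵐᵒᵖ P) : s = ∑ i, b.coord (lo m i) s • b (lo m i) := by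
  rw [← Submodule.restrictScalars_mem K, ← hb.socle_eq,
    Submodule.mem_span_range_iff_exists_fun] at hs
  obtain ⟨x, rfl⟩ := hs
  exact Finset.sum_congr rfl fun i _ => by rw [coord_lo_sum]

theorem IsAdaptedBasis.lo_mem_socle (hb : IsAdaptedBasis hτ b) (i : Fin d) :
    b (lo m i) ∈ socle Hᵐᵒᵖ P := by
  rw [← Submodule.restrictScalars_mem K, ← hb.socle_eq]
  exact Submodule.subset_span ⟨i, rfl⟩

omit [FiniteDimensional K H] in
theorem sum_smul_right_smul (x : Fin d → K) (y : Fin d → P) (h : H) :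
    (∑ j, x j • y j) <• h = ∑ j, x j • (y j <• h) := by
  rw [Finset.smul_sum]
  exact Finset.sum_congr rfl fun j _ => smul_comm _ _ _

theorem IsAdaptedBasis.coord_hi_smul (hb : IsAdaptedBasis hτ b) (v : P) (h : H) (i : Fin d) :
    b.coord (hi m i) (v <• h) =
      ∑ j, b.coord (hi m j) v * b.coord (hi m i) (b (hi m j) <• h) := by
  have h1 := (hb.mem_jacobson_iff).1
    ((Module.jacobson Hᵐᵒᵖ P).smul_mem (MulOpposite.op h) (hb.sub_sum_mem_jacobson v)) i
  rw [smul_sub, map_sub, sub_eq_zero, sum_smul_right_smul, map_sum] at h1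
  simpa using h1

theorem IsAdaptedBasis.coord_lo_smul (hb : IsAdaptedBasis hτ b) {s : P}
    (hs : s ∈ socle Hᵐᵒᵖ P) (h : H) (i : Fin d) :
    b.coord (lo m i) (s <• h) =
      ∑ j, b.coord (lo m j) s * b.coord (hi m i) (b (hi m j) <• nakayama hτ h) := by
  conv_lhs => rw [hb.eq_sum_of_mem_socle hs]
  rw [sum_smul_right_smul, map_sum]
  exact Finset.sum_congr rfl fun j _ => by rw [map_smul, hb.matrix_eq, smul_eq_mul]

theorem isArtinianRing_op (K H : Type*) [Field K] [Ring H] [Algebra K H]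
    [FiniteDimensional K H] : IsArtinianRing Hᵐᵒᵖ :=
  have : FiniteDimensional K Hᵐᵒᵖ := Module.Finite.equiv (MulOpposite.opLinearEquiv K)
  isArtinian_of_tower K inferInstance

theorem IsAdaptedBasis.pos (hb : IsAdaptedBasis hτ b) (hP : IsPIM Hᵐᵒᵖ P) : 0 < d := by
  have := isArtinianRing_op K H
  rw [Nat.pos_iff_ne_zero]
  rintro rfl
  exact hP.isCoatom_jacobson.1 (eq_top_iff.2 fun x _ => hb.mem_jacobson_iff.2 fun i => i.elim0)

/-- The socle is the head twisted by the Nakayama automorphism, hence simple. -/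
theorem IsAdaptedBasis.isSimpleModule_socle (hb : IsAdaptedBasis hτ b) (hP : IsPIM Hᵐᵒᵖ P) :
    IsSimpleModule Hᵐᵒᵖ (socle Hᵐᵒᵖ P) := by
  have := isArtinianRing_op K H
  have hhead := (isSimpleModule_iff_toSpanSingleton_surjective.1 hP.isSimpleModule_head).2
  rw [isSimpleModule_iff_toSpanSingleton_surjective]
  refine ⟨⟨⟨b (lo m ⟨0, hb.pos hP⟩), hb.lo_mem_socle _⟩, 0, fun h => b.ne_zero _
    (congrArg Subtype.val h)⟩, ?_⟩
  rintro ⟨s, hs⟩ hs0 ⟨t, ht⟩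
  -- On the socle, `φ` followed by the projection is the linear isomorphism `b_i ↦ b_{m+i}` onto the
  -- head, which intertwines `h` with `α h`.
  let φ : P → P := fun s => ∑ j, b.coord (lo m j) s • b (hi m j)
  have hφ : (Submodule.Quotient.mk (φ s) : Head Hᵐᵒᵖ P) ≠ 0 := by
    rw [Ne, Submodule.Quotient.mk_eq_zero, hb.mem_jacobson_iff]
    intro h
    refine hs0 (Subtype.ext ?_)
    change s = 0
    rw [hb.eq_sum_of_mem_socle hs]
    exact Finset.sum_eq_zero fun i _ => by
      rw [← coord_hi_sum (b := b) (fun j => b.coord (lo m j) s) i, h i, zero_smul]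
  obtain ⟨k, hk⟩ := hhead _ hφ (Submodule.Quotient.mk (φ t))
  obtain ⟨k, rfl⟩ := MulOpposite.op_surjective k
  obtain ⟨h, rfl⟩ := (nakayama hτ).surjective k
  rw [LinearMap.toSpanSingleton_apply, ← Submodule.Quotient.mk_smul, Submodule.Quotient.eq,
    hb.mem_jacobson_iff] at hk
  refine ⟨MulOpposite.op h, Subtype.ext ?_⟩
  change s <• h = t
  rw [hb.eq_sum_of_mem_socle ((socle Hᵐᵒᵖ P).smul_mem (MulOpposite.op h) hs),
    hb.eq_sum_of_mem_socle ht]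
  refine Finset.sum_congr rfl fun i _ => ?_
  have := hk i
  rw [map_sub, sub_eq_zero, coord_hi_sum, hb.coord_hi_smul] at this
  simp only [φ, coord_hi_sum] at this
  rw [hb.coord_lo_smul hs, this]

/-- By Schur's lemma, every endomorphism of `P` acts on the simple socle by a scalar. -/
theorem IsAdaptedBasis.exists_scalar_on_socle (hK : IsSplittingFieldFor K H)
    (hb : IsAdaptedBasis hτ b) (hP : IsPIM Hᵐᵒᵖ P) (g : Module.End Hᵐᵒᵖ P) :
    ∃ k : K, ∀ s ∈ socle Hᵐᵒᵖ P, g s = k • s := by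
  have hS := hb.isSimpleModule_socle hP
  have hmap : ∀ s ∈ socle Hᵐᵒᵖ P, g s ∈ socle Hᵐᵒᵖ P := by
    intro s hs
    rcases LinearMap.injective_or_eq_zero (g ∘ₗ (socle Hᵐᵒᵖ P).subtype) with h | h
    · have : IsSimpleModule Hᵐᵒᵖ (LinearMap.range (g ∘ₗ (socle Hᵐᵒᵖ P).subtype)) :=
        IsSimpleModule.congr (LinearEquiv.ofInjective _ h).symm
      exact le_sSup (a := LinearMap.range (g ∘ₗ (socle Hᵐᵒᵖ P).subtype)) this ⟨⟨s, hs⟩, rfl⟩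
    · have : g s = 0 := LinearMap.congr_fun h ⟨s, hs⟩
      rw [this]
      exact zero_mem _
  obtain ⟨k, hk⟩ := hK.exists_smul hS (LinearMap.restrict g hmap)
  refine ⟨k, fun s hs => ?_⟩
  have := congrArg Subtype.val (hk ⟨s, hs⟩)
  rw [← right_smul_algebraMap (H := H)]
  exact this

/-- For `s` in the socle, left multiplication by `h` acts on the `Θ_i(s)` through the matrix of `h`
on the head: `τ (h a) = τ (a (α⁻¹ h))`, and `α⁻¹ h` acts on the socle as `h` acts on the head. -/
theorem IsAdaptedBasis.mul_frobHom (hb : IsAdaptedBasis hτ b) {s : P}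
    (hs : s ∈ socle Hᵐᵒᵖ P) (h : H) (i : Fin d) :
    h * frobHom hτ (b.coord (lo m i)) s =
      ∑ j, b.coord (hi m i) (b (hi m j) <• h) • frobHom hτ (b.coord (lo m j)) s := by
  obtain ⟨k, rfl⟩ := (nakayama hτ).surjective h
  refine ext_left hτ fun y => ?_
  rw [mul_assoc, ← tau_nakayama, mul_assoc, tau_frobHom_mul, MulOpposite.op_mul, mul_smul,
    hb.coord_lo_smul ((socle Hᵐᵒᵖ P).smul_mem _ hs), Finset.sum_mul, map_sum]
  refine Finset.sum_congr rfl fun j _ => ?_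
  rw [smul_mul_assoc, τ.map_smul, tau_frobHom_mul, smul_eq_mul, mul_comm]

/-- The endomorphism `p ↦ v Θ(p)` of `P`, where `Θ` is attached to a linear form `ξ`. -/
noncomputable def frobEnd (hτ : IsFrobenius τ) (ξ : Module.Dual K P) (v : P) :
    Module.End Hᵐᵒᵖ P :=
  actHom v ∘ₗ frobHom hτ ξ

omit [FiniteDimensional K H] in
theorem frobEnd_apply (ξ : Module.Dual K P) (v p : P) :
    frobEnd hτ ξ v p = v <• frobHom hτ ξ p := rfl

/-- The Schur relations. The scalar `β_i(v)` by which `p ↦ v Θ_i(p)` acts on the socle defines a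
homomorphism `v ↦ ∑ i, β_i(v) b_{m+i}` from `P` to its head. It factors through the head, so by
Schur's lemma it is a multiple `κ` of the projection, and projectivity of `P` excludes `κ = 0`. -/
theorem IsAdaptedBasis.exists_schur (hK : IsSplittingFieldFor K H)
    (hb : IsAdaptedBasis hτ b) (hP : IsPIM Hᵐᵒᵖ P) :
    ∃ κ : K, κ ≠ 0 ∧ ∀ (v : P) (i : Fin d), ∀ s ∈ socle Hᵐᵒᵖ P,
      v <• frobHom hτ (b.coord (lo m i)) s = (κ * b.coord (hi m i) v) • s := by
  have := isArtinianRing_op K H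
  let s₀ := b (lo m ⟨0, hb.pos hP⟩)
  have hs₀ : s₀ ∈ socle Hᵐᵒᵖ P := hb.lo_mem_socle _
  let β : Fin d → P → K := fun i v =>
    b.coord (lo m ⟨0, hb.pos hP⟩) (v <• frobHom hτ (b.coord (lo m i)) s₀)
  have hβ : ∀ (v : P) (i : Fin d), ∀ s ∈ socle Hᵐᵒᵖ P,
      v <• frobHom hτ (b.coord (lo m i)) s = β i v • s := by
    intro v i
    obtain ⟨k, hk⟩ := hb.exists_scalar_on_socle hK hP (frobEnd hτ (b.coord (lo m i)) v)
    have : β i v = k := by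
      have h := hk s₀ hs₀
      rw [frobEnd_apply] at h
      simp only [β]
      rw [h, map_smul]
      simp [s₀]
    rw [this]
    exact hk
  have hβadd : ∀ i v w, β i (v + w) = β i v + β i w := fun i v w => by
    simp only [β, smul_add, map_add]
  have hβsmul : ∀ (i : Fin d) (v : P) (h : H), β i (v <• h) =
      ∑ j, b.coord (hi m i) (b (hi m j) <• h) * β j v := by
    intro i v h
    simp only [β]
    rw [← mul_smul, ← MulOpposite.op_mul, hb.mul_frobHom hs₀, ← actLin_apply (K := K), map_sum,
      map_sum]
    exact Finset.sum_congr rfl fun j _ => by rw [map_smul, map_smul, smul_eq_mul]; rfl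
  let Γ : P →ₗ[Hᵐᵒᵖ] Head Hᵐᵒᵖ P :=
    { toFun := fun v => Submodule.Quotient.mk (∑ i, β i v • b (hi m i))
      map_add' := fun v w => by
        rw [← Submodule.Quotient.mk_add, ← Finset.sum_add_distrib]
        simp only [hβadd, add_smul]
      map_smul' := fun h v => by
        obtain ⟨h, rfl⟩ := MulOpposite.op_surjective h
        rw [RingHom.id_apply, ← Submodule.Quotient.mk_smul, Submodule.Quotient.eq,
          hb.mem_jacobson_iff]
        intro i
        rw [map_sub, coord_hi_sum, hb.coord_hi_smul, hβsmul, sub_eq_zero]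
        exact Finset.sum_congr rfl fun j _ => by rw [coord_hi_sum, mul_comm] }
  have hΓ : Module.jacobson Hᵐᵒᵖ P ≤ LinearMap.ker Γ := by
    have h := Module.le_comap_jacobson Γ
    rwa [Module.jacobson_quotient_jacobson] at h
  obtain ⟨κ, hκ⟩ := hK.exists_smul hP.isSimpleModule_head ((Module.jacobson Hᵐᵒᵖ P).liftQ Γ hΓ)
  have hβκ : ∀ i v, β i v = κ * b.coord (hi m i) v := by
    intro i v
    have h : (Submodule.Quotient.mk (∑ i, β i v • b (hi m i)) : Head Hᵐᵒᵖ P) = _ :=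
      hκ (Submodule.Quotient.mk v)
    rw [← Submodule.Quotient.mk_smul, right_smul_algebraMap, Submodule.Quotient.eq,
      hb.mem_jacobson_iff] at h
    have := h i
    rwa [map_sub, coord_hi_sum, map_smul, sub_eq_zero] at this
  refine ⟨κ, ?_, fun v i s hs => by rw [hβ v i s hs, hβκ]⟩
  rintro rfl
  have := hP.projective
  obtain ⟨ξ, v, hv⟩ := exists_frobHom_right_smul_ne_zero hτ (b.ne_zero _ : s₀ ≠ 0)
  -- On the socle, `ξ` is a combination of the first `d` coordinates.
  have hξ : frobHom hτ ξ s₀ = ∑ j, ξ (b (lo m j)) • frobHom hτ (b.coord (lo m j)) s₀ := by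
    refine ext_left hτ fun h => ?_
    rw [tau_frobHom_mul, Finset.sum_mul, map_sum,
      hb.eq_sum_of_mem_socle ((socle Hᵐᵒᵖ P).smul_mem (MulOpposite.op h) hs₀), map_sum]
    refine Finset.sum_congr rfl fun j _ => ?_
    rw [smul_mul_assoc, τ.map_smul, ξ.map_smul, tau_frobHom_mul, smul_eq_mul, smul_eq_mul, mul_comm]
  refine hv ?_
  rw [hξ, ← actLin_apply (K := K), map_sum]
  refine Finset.sum_eq_zero fun j _ => ?_
  rw [map_smul, actLin_apply, hβ v j s₀ hs₀, hβκ, zero_mul, zero_smul, smul_zero]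

end Adapted

/-! ### Right ideals generated by idempotents -/

section RightIdeal

variable {H : Type*} [Ring H]

theorem self_mem_rightIdeal (e : H) : e ∈ rightIdeal e :=
  Submodule.mem_span_singleton_self e

/-- If `p e` generates the PIM `P`, then `x ↦ p x` maps `e H` onto `P`; a surjection `P → e H` in
the other direction shows that it is an isomorphism. -/
theorem IsPIM.nonempty_rightIdeal_equiv [IsArtinianRing Hᵐᵒᵖ] {P : Type*} [AddCommGroup P]
    [Module Hᵐᵒᵖ P] (hP : IsPIM Hᵐᵒᵖ P) {e : H} (he : e * e = e) {θ : P →ₗ[Hᵐᵒᵖ] H}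
    (heθ : e ∈ LinearMap.range θ) {p : P} (hp : p <• e ∉ Module.jacobson Hᵐᵒᵖ P) :
    Nonempty (rightIdeal e ≃ₗ[Hᵐᵒᵖ] P) := by
  have := hP.finite
  let f : rightIdeal e →ₗ[Hᵐᵒᵖ] P := actHom p ∘ₗ (rightIdeal e).subtype
  have hf : Function.Surjective f := by
    rw [← LinearMap.range_eq_top]
    by_contra h
    exact hp (hP.le_jacobson h ⟨⟨e, self_mem_rightIdeal e⟩, rfl⟩)
  have hmem : ∀ h, e * h ∈ rightIdeal e := fun h => (mem_rightIdeal _ _).2 ⟨h, rfl⟩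
  let θ' : P →ₗ[Hᵐᵒᵖ] rightIdeal e := (actHom e ∘ₗ θ).codRestrict _ fun x => hmem (θ x)
  have hθ' : Function.Surjective θ' := by
    rintro ⟨x, hx⟩
    obtain ⟨h, rfl⟩ := (mem_rightIdeal _ _).1 hx
    obtain ⟨q, hq⟩ := heθ
    refine ⟨q <• h, Subtype.ext ?_⟩
    change e * θ (q <• h) = e * h
    rw [map_smul, hq, op_smul_eq_mul, ← mul_assoc, he]
  have hinj := IsNoetherian.injective_of_surjective_endomorphism (f ∘ₗ θ') (hf.comp hθ')
  refine ⟨LinearEquiv.ofBijective f ⟨?_, hf⟩⟩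
  rw [injective_iff_map_eq_zero]
  intro x hx
  obtain ⟨y, rfl⟩ := hθ' x
  rw [hinj (hx.trans (map_zero (f ∘ₗ θ')).symm), map_zero]

/-- An idempotent `e` with `e H` indecomposable is primitive. -/
theorem IsPIM.eq_zero_or_eq_of_idempotent {P : Type*} [AddCommGroup P] [Module Hᵐᵒᵖ P]
    (hP : IsPIM Hᵐᵒᵖ P) {e : H} (ρ : rightIdeal e ≃ₗ[Hᵐᵒᵖ] P) {t : H} (ht : t * t = t)
    (het : e * t = t) (hte : t * e = t) : t = 0 ∨ t = e := by
  let g : Module.End Hᵐᵒᵖ (rightIdeal e) :=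
    (actHom t ∘ₗ (rightIdeal e).subtype).codRestrict _ fun x =>
      (mem_rightIdeal _ _).2 ⟨t * x, by
        rw [← mul_assoc, het]
        rfl⟩
  have hg : ∀ x, g (g x) = g x := fun x => Subtype.ext (by
    change t * (t * x) = t * x
    rw [← mul_assoc, ht])
  have hge : ((g ⟨e, self_mem_rightIdeal e⟩ : rightIdeal e) : H) = t := hte
  rcases hP.eq_zero_or_eq_one_of_isIdempotentElem
    (g := ρ.toLinearMap ∘ₗ g ∘ₗ ρ.symm.toLinearMap) (by
      ext x
      simp [hg]) with h | h
  · left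
    have := LinearMap.congr_fun h (ρ ⟨e, self_mem_rightIdeal e⟩)
    simp only [LinearMap.comp_apply, LinearEquiv.coe_coe, LinearEquiv.symm_apply_apply,
      LinearMap.zero_apply, LinearEquiv.map_eq_zero_iff] at this
    rw [← hge, this]
    rfl
  · right
    have := LinearMap.congr_fun h (ρ ⟨e, self_mem_rightIdeal e⟩)
    simp only [LinearMap.comp_apply, LinearEquiv.coe_coe, LinearEquiv.symm_apply_apply,
      Module.End.one_apply, EmbeddingLike.apply_eq_iff_eq] at this
    rw [← hge, this]

/-- If `e` is a primitive idempotent and `q e` generates the PIM `Q`, then the surjection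
`e H → Q`, `x ↦ q x`, splits, hence is an isomorphism. -/
theorem IsPIM.nonempty_rightIdeal_equiv_of_primitive [IsArtinianRing Hᵐᵒᵖ] {Q : Type*}
    [AddCommGroup Q] [Module Hᵐᵒᵖ Q] (hQ : IsPIM Hᵐᵒᵖ Q) {e : H} (he : e * e = e)
    (hprim : ∀ t : H, t * t = t → e * t = t → t * e = t → t = 0 ∨ t = e) {q : Q}
    (hq : q <• e ∉ Module.jacobson Hᵐᵒᵖ Q) : Nonempty (rightIdeal e ≃ₗ[Hᵐᵒᵖ] Q) := by
  have := hQ.projective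
  let f : rightIdeal e →ₗ[Hᵐᵒᵖ] Q := actHom q ∘ₗ (rightIdeal e).subtype
  have hf : Function.Surjective f := by
    rw [← LinearMap.range_eq_top]
    by_contra h
    exact hq (hQ.le_jacobson h ⟨⟨e, self_mem_rightIdeal e⟩, rfl⟩)
  obtain ⟨σ, hσ⟩ := Module.projective_lifting_property f LinearMap.id hf
  have hfσ : ∀ x, f (σ x) = x := LinearMap.congr_fun hσ
  let e' : rightIdeal e := ⟨e, self_mem_rightIdeal e⟩
  have hgen : ∀ x : rightIdeal e, x = e' <• (x : H) := by
    rintro ⟨x, hx⟩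
    obtain ⟨h, rfl⟩ := (mem_rightIdeal _ _).1 hx
    refine Subtype.ext ?_
    change e * h = e * (e * h)
    rw [← mul_assoc, he]
  -- The projection of `e H` onto a copy of `Q` is left multiplication by `t`.
  let t : rightIdeal e := σ (f e')
  have hσf : ∀ x : rightIdeal e, ((σ (f x) : rightIdeal e) : H) = t * (x : H) := by
    intro x
    conv_lhs => rw [hgen x, map_smul, map_smul]
    rfl
  have htt : (t : H) * t = t := by
    rw [← hσf]
    simp only [t, hfσ]
  have het : e * (t : H) = t := (congrArg Subtype.val (hgen t)).symm
  have hte : (t : H) * e = t := (hσf e').symm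
  rcases hprim t htt het hte with h | h
  · refine absurd ?_ hq
    have h0 : t = 0 := Subtype.ext h
    have h1 : f e' = 0 := by rw [← hfσ (f e'), show σ (f e') = 0 from h0, map_zero]
    change f e' ∈ _
    rw [h1]
    exact zero_mem _
  · refine ⟨LinearEquiv.ofBijective f ⟨?_, hf⟩⟩
    rw [injective_iff_map_eq_zero]
    intro x hx
    have h1 := hσf x
    rw [hx, map_zero, h] at h1
    rw [hgen x]
    exact Subtype.ext h1.symm

end RightIdeal

/-! ### The idempotents of an adapted basis -/

section Idempotents

variable {K H : Type*} [Field K] [Ring H] [Algebra K H] [FiniteDimensional K H]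
  {τ : H →ₗ[K] K} {hτ : IsFrobenius τ} {W : Type*} [Fintype W] {B : Module.Basis W K H}
  {P : Type*} [AddCommGroup P] [Module K P] [Module Hᵐᵒᵖ P] [IsScalarTower K Hᵐᵒᵖ P]

omit [FiniteDimensional K H] in
theorem cconst_eq {n : ℕ} (b : Module.Basis (Fin n) K P) (i j s t : Fin n) :
    cconst hτ B b i j s t = b.coord j (b t <• frobHom hτ (b.coord s) (b i)) := by
  rw [← sum_smul_dualBasis hτ B, ← actLin_apply (K := K), map_sum, map_sum, cconst]
  simp

omit [FiniteDimensional K H] in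
theorem eTilde_eq {n : ℕ} (b : Module.Basis (Fin n) K P) (c : K) (s t : Fin n) :
    eTilde hτ B b c s t = c⁻¹ • frobHom hτ (b.coord s) (b t) := by
  rw [eTilde, sum_smul_dualBasis hτ B]

theorem ETilde_eq {n : ℕ} (b : Module.Basis (Fin n) K P) (c : K) (s t : Fin n) :
    ETilde hτ B b c s t = (nakayama hτ).symm (eTilde hτ B b c s t) := by
  rw [ETilde, sum_dualBasis_smul hτ B, eTilde_eq, map_smul]

omit [FiniteDimensional K H] in
theorem mul_mem_range (θ : P →ₗ[Hᵐᵒᵖ] H) {x : H} (hx : x ∈ LinearMap.range θ) (y : H) :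
    x * y ∈ LinearMap.range θ :=
  (LinearMap.range θ).smul_mem (MulOpposite.op y) hx

omit [FiniteDimensional K H] in
theorem eTilde_mem_range {n : ℕ} (b : Module.Basis (Fin n) K P) (c : K) (s t : Fin n) :
    eTilde hτ B b c s t ∈ LinearMap.range (frobHom hτ (b.coord s)) := by
  rw [eTilde_eq, Algebra.smul_def, Algebra.commutes]
  exact mul_mem_range _ ⟨_, rfl⟩ _

variable {m d : ℕ} {b : Module.Basis (Fin (m + d)) K P}

/-- On the head of `P`, the element `ẽ_i` acts as the `i`-th diagonal matrix unit. -/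
theorem IsAdaptedBasis.smul_eTilde_sub_mem (hb : IsAdaptedBasis hτ b) (hP : IsPIM Hᵐᵒᵖ P)
    {c : K} (hc : c ≠ 0) (hcs : ∀ (v : P) (i : Fin d), ∀ s ∈ socle Hᵐᵒᵖ P,
      v <• frobHom hτ (b.coord (lo m i)) s = (c * b.coord (hi m i) v) • s)
    (v : P) (i : Fin d) :
    v <• eTilde hτ B b c (lo m i) (hi m i) - b.coord (hi m i) v • b (hi m i) ∈
      Module.jacobson Hᵐᵒᵖ P := by
  have := isArtinianRing_op K H
  -- This endomorphism vanishes on the socle, so it is not injective.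
  let g : Module.End Hᵐᵒᵖ P := frobEnd hτ (b.coord (lo m i)) v -
    (c * b.coord (hi m i) v) • (1 : Module.End Hᵐᵒᵖ P)
  have hg : g (b (lo m i)) = 0 :=
    sub_eq_zero.2 (hcs v i _ (hb.lo_mem_socle i))
  have h := hP.apply_mem_jacobson (b.ne_zero _) hg (b (hi m i))
  have h' := ((Module.jacobson Hᵐᵒᵖ P).restrictScalars K).smul_mem c⁻¹ h
  have hgb : g (b (hi m i)) = v <• frobHom hτ (b.coord (lo m i)) (b (hi m i)) -
    (c * b.coord (hi m i) v) • b (hi m i) := rfl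
  rw [hgb, smul_sub, smul_smul, inv_mul_cancel_left₀ hc, ← smul_assoc, ← MulOpposite.op_smul,
    ← eTilde_eq (B := B)] at h'
  exact h'

theorem IsAdaptedBasis.coord_smul_eTilde (hb : IsAdaptedBasis hτ b) (hP : IsPIM Hᵐᵒᵖ P)
    {c : K} (hc : c ≠ 0) (hcs : ∀ (v : P) (i : Fin d), ∀ s ∈ socle Hᵐᵒᵖ P,
      v <• frobHom hτ (b.coord (lo m i)) s = (c * b.coord (hi m i) v) • s)
    (v : P) (i k : Fin d) :
    b.coord (hi m k) (v <• eTilde hτ B b c (lo m i) (hi m i)) =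
      if i = k then b.coord (hi m i) v else 0 := by
  have h := hb.mem_jacobson_iff.1 (hb.smul_eTilde_sub_mem (B := B) hP hc hcs v i) k
  rw [map_sub, sub_eq_zero] at h
  rw [h]
  simp [Finsupp.single_apply]

theorem IsAdaptedBasis.sub_mul_self_mem_jacobson (hb : IsAdaptedBasis hτ b) {i : Fin d} {x : H}
    {θ : P →ₗ[Hᵐᵒᵖ] H} (hxθ : x ∈ LinearMap.range θ)
    (hx : ∀ v k, b.coord (hi m k) (v <• x) = if i = k then b.coord (hi m i) v else 0) :
    x - x * x ∈ Ring.jacobson H := by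
  have : IsNoetherianRing H := IsNoetherianRing.of_finite K H
  refine mem_jacobson_of_right_smul_mem θ (sub_mem hxθ (mul_mem_range θ hxθ x)) fun v => ?_
  rw [hb.mem_jacobson_iff]
  intro k
  rw [MulOpposite.op_sub, sub_smul, MulOpposite.op_mul, mul_smul, map_sub, hx, hx, hx, if_pos rfl,
    sub_self]

theorem IsAdaptedBasis.mul_mem_jacobson (hb : IsAdaptedBasis hτ b) {i j : Fin d} (hij : i ≠ j)
    {x y : H} {θ : P →ₗ[Hᵐᵒᵖ] H} (hxθ : x ∈ LinearMap.range θ)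
    (hx : ∀ v k, b.coord (hi m k) (v <• x) = if i = k then b.coord (hi m i) v else 0)
    (hy : ∀ v k, b.coord (hi m k) (v <• y) = if j = k then b.coord (hi m j) v else 0) :
    x * y ∈ Ring.jacobson H := by
  have : IsNoetherianRing H := IsNoetherianRing.of_finite K H
  refine mem_jacobson_of_right_smul_mem θ (mul_mem_range θ hxθ y) fun v => ?_
  rw [hb.mem_jacobson_iff]
  intro k
  rw [MulOpposite.op_mul, mul_smul, hy, hx, if_neg hij, ite_self]

omit [FiniteDimensional K H] in
theorem aeval_mul_aeval_mem_jacobson {a : ℕ} (ha : a ≠ 0) {x y : H}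
    (hxy : x * y ∈ Ring.jacobson H) :
    aeval x (idemPoly a) * aeval y (idemPoly a) ∈ Ring.jacobson H := by
  obtain ⟨g, hg⟩ := exists_idemPoly_eq_X_mul ha
  have h1 : aeval x (idemPoly a) = aeval x g * x := by rw [hg, mul_comm, map_mul, aeval_X]
  have h2 : aeval y (idemPoly a) = y * aeval y g := by rw [hg, map_mul, aeval_X]
  rw [h1, h2, mul_assoc, ← mul_assoc x]
  exact Ideal.mul_mem_left _ _ (Ideal.mul_mem_right _ _ hxy)

/-- Since `f - 1` is divisible by `X - 1`, the element `f(x)` fixes every vector of the head which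
`x` fixes. -/
theorem IsAdaptedBasis.hi_smul_aeval_sub_mem (hb : IsAdaptedBasis hτ b) {i : Fin d} {x : H}
    (hx : ∀ v k, b.coord (hi m k) (v <• x) = if i = k then b.coord (hi m i) v else 0) (a : ℕ) :
    b (hi m i) <• aeval x (idemPoly a) - b (hi m i) ∈ Module.jacobson Hᵐᵒᵖ P := by
  obtain ⟨g, hg⟩ := exists_idemPoly_sub_one_eq a
  have h1 : aeval x (idemPoly a) = (x - 1) * aeval x g + 1 := by
    rw [← sub_eq_iff_eq_add, ← map_one (aeval (R := ℤ) x), ← map_sub, hg, map_mul, map_sub, aeval_X]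
  rw [h1, MulOpposite.op_add, add_smul, MulOpposite.op_one, one_smul, add_sub_cancel_right,
    MulOpposite.op_mul, mul_smul]
  refine Submodule.smul_mem _ _ (hb.mem_jacobson_iff.2 fun k => ?_)
  rw [MulOpposite.op_sub, sub_smul, MulOpposite.op_one, one_smul, map_sub, hx]
  simp [Finsupp.single_apply]

theorem IsAdaptedBasis.hi_notMem_jacobson (hb : IsAdaptedBasis hτ b) (i : Fin d) :
    b (hi m i) ∉ Module.jacobson Hᵐᵒᵖ P := fun h => by
  simpa using hb.mem_jacobson_iff.1 h i

/-- If `e` fixes `b_{m+i}` modulo the radical, the twist `α⁻¹ e` fixes the vector `b_i` of the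
socle. -/
theorem IsAdaptedBasis.lo_smul_eq (hb : IsAdaptedBasis hτ b) {i : Fin d} {e : H}
    (he : b (hi m i) <• e - b (hi m i) ∈ Module.jacobson Hᵐᵒᵖ P) :
    b (lo m i) <• (nakayama hτ).symm e = b (lo m i) := by
  rw [hb.eq_sum_of_mem_socle ((socle Hᵐᵒᵖ P).smul_mem _ (hb.lo_mem_socle i))]
  conv_rhs => rw [hb.eq_sum_of_mem_socle (hb.lo_mem_socle i)]
  refine Finset.sum_congr rfl fun k _ => ?_
  have h := hb.mem_jacobson_iff.1 he k
  rw [map_sub, sub_eq_zero] at h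
  rw [hb.matrix_eq, AlgEquiv.apply_symm_apply, h]
  simp [Finsupp.single_apply]

end Idempotents

end FrobPIM

theorem theorem4p1 {K H : Type*} [Field K] [Ring H] [Algebra K H]
    [FiniteDimensional K H] (hK : FrobPIM.IsSplittingFieldFor K H)
    (τ : H →ₗ[K] K) (hτ : FrobPIM.IsFrobenius τ)
    {W : Type*} [Fintype W] (B : Module.Basis W K H)
    {P : Type*} [AddCommGroup P] [Module K P] [Module Hᵐᵒᵖ P] [IsScalarTower K Hᵐᵒᵖ P]
    (hP : FrobPIM.IsPIM Hᵐᵒᵖ P)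
    {m d : ℕ} (b : Module.Basis (Fin (m + d)) K P) (hb : FrobPIM.IsAdaptedBasis hτ b) :
    ∃ hd : 0 < d,
      let lo : Fin d → Fin (m + d) := fun i => i.castLE (Nat.le_add_left d m)
      let hi : Fin d → Fin (m + d) := fun i => i.natAdd m
      let c : K := FrobPIM.cconst hτ B b (lo ⟨0, hd⟩) (lo ⟨0, hd⟩) (lo ⟨0, hd⟩) (hi ⟨0, hd⟩)
      c ≠ 0 ∧
      (∃ a : ℕ, Ring.jacobson H ^ a = ⊥) ∧
      ∀ a : ℕ, Ring.jacobson H ^ a = ⊥ →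
        let f : ℤ[X] := FrobPIM.idemPoly a
        let e : Fin d → H := fun i => aeval (FrobPIM.eTilde hτ B b c (lo i) (hi i)) f
        let E : Fin d → H := fun i => aeval (FrobPIM.ETilde hτ B b c (lo i) (hi i)) f
        ((∀ i, e i * e i = e i) ∧
          (∀ i, Nonempty (FrobPIM.rightIdeal (e i) ≃ₗ[Hᵐᵒᵖ] P)) ∧
          (∀ i i', i ≠ i' → e i * e i' ∈ Ring.jacobson H)) ∧
        ((∀ i, E i * E i = E i) ∧
          (∀ (Q : Type*) [AddCommGroup Q] [Module Hᵐᵒᵖ Q], FrobPIM.IsPIM Hᵐᵒᵖ Q →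
            Nonempty (FrobPIM.Head Hᵐᵒᵖ Q ≃ₗ[Hᵐᵒᵖ] FrobPIM.socle Hᵐᵒᵖ P) →
            ∀ i, Nonempty (FrobPIM.rightIdeal (E i) ≃ₗ[Hᵐᵒᵖ] Q)) ∧
          (∀ i i', i ≠ i' → E i * E i' ∈ Ring.jacobson H)) := by
  have := FrobPIM.isArtinianRing_op K H
  have : IsArtinianRing H := isArtinian_of_tower K inferInstance
  have := hP.nontrivial
  have hd := hb.pos hP
  obtain ⟨κ, hκ, hκs⟩ := hb.exists_schur hK hP
  refine ⟨hd, ?_⟩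
  intro lo hi c
  have hc : c = κ := by
    change FrobPIM.cconst hτ B b _ _ _ _ = κ
    rw [FrobPIM.cconst_eq, hκs _ _ _ (hb.lo_mem_socle _), map_smul]
    simp [lo, hi]
  clear_value c
  subst hc
  refine ⟨hκ, IsSemiprimaryRing.isNilpotent, ?_⟩
  intro a ha f e E
  -- For `a = 0` the polynomial is `1`, but then `H = 0`, and `P` would vanish.
  have ha0 : a ≠ 0 := by
    rintro rfl
    rw [Submodule.pow_zero, Ideal.one_eq_top] at ha
    obtain ⟨p, hp⟩ := exists_ne (0 : P)
    have h1 : (1 : H) = 0 := (Submodule.mem_bot H).1 (ha ▸ Submodule.mem_top)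
    refine hp ?_
    rw [← one_smul Hᵐᵒᵖ p, ← MulOpposite.op_one, h1, MulOpposite.op_zero, zero_smul]
  have hx := fun i v k => hb.coord_smul_eTilde (B := B) hP hκ hκs v i k
  have hr : ∀ i, FrobPIM.eTilde hτ B b c (lo i) (hi i) ∈ LinearMap.range _ :=
    fun i => FrobPIM.eTilde_mem_range b c (lo i) (hi i)
  have hidem : ∀ i, e i * e i = e i := by
    refine fun i => FrobPIM.isIdempotentElem_aeval_idemPoly ((Submodule.mem_bot H).1 ?_)
    rw [← ha]
    exact Ideal.pow_mem_pow (hb.sub_mul_self_mem_jacobson (hr i) (hx i)) a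
  have horth : ∀ i i', i ≠ i' → e i * e i' ∈ Ring.jacobson H := fun i i' h =>
    FrobPIM.aeval_mul_aeval_mem_jacobson ha0 (hb.mul_mem_jacobson h (hr i) (hx i) (hx i'))
  have hhead : ∀ i, b (hi i) <• e i - b (hi i) ∈ Module.jacobson Hᵐᵒᵖ P := fun i =>
    hb.hi_smul_aeval_sub_mem (hx i) a
  have heP : ∀ i, Nonempty (FrobPIM.rightIdeal (e i) ≃ₗ[Hᵐᵒᵖ] P) := by
    intro i
    have hmem : e i ∈ LinearMap.range (FrobPIM.frobHom hτ (b.coord (lo i))) := by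
      obtain ⟨g, hg⟩ := FrobPIM.exists_idemPoly_eq_X_mul ha0
      simp only [e, f]
      rw [hg, map_mul, aeval_X]
      exact FrobPIM.mul_mem_range _ (hr i) _
    refine hP.nonempty_rightIdeal_equiv (hidem i) hmem (p := b (hi i)) fun h => ?_
    refine hb.hi_notMem_jacobson i ?_
    simpa using sub_mem h (hhead i)
  -- All claims about `E i` follow by transport along the Nakayama automorphism.
  have hE : ∀ i, E i = (FrobPIM.nakayama hτ).symm (e i) := by
    intro i
    simp only [E, e]
    rw [FrobPIM.ETilde_eq]
    exact aeval_algHom_apply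
      ((FrobPIM.nakayama hτ).symm : H →+* H).toIntAlgHom _ f
  have hEidem : ∀ i, E i * E i = E i := fun i => by rw [hE, ← map_mul, hidem]
  refine ⟨⟨hidem, heP, horth⟩, hEidem, ?_, ?_⟩
  · rintro Q _ _ hQ ⟨ψ⟩ i
    let s : FrobPIM.socle Hᵐᵒᵖ P := ⟨b (lo i), hb.lo_mem_socle i⟩
    have hs : s <• E i = s := Subtype.ext (by
      rw [hE]
      exact hb.lo_smul_eq (hhead i))
    obtain ⟨q, hq⟩ := Submodule.Quotient.mk_surjective _ (ψ.symm s)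
    refine hQ.nonempty_rightIdeal_equiv_of_primitive (hEidem i) ?_ (q := q) ?_
    · intro t h1 h2 h3
      obtain ⟨ρ⟩ := heP i
      have hαE : FrobPIM.nakayama hτ (E i) = e i := by rw [hE, AlgEquiv.apply_symm_apply]
      have := hP.eq_zero_or_eq_of_idempotent ρ (t := FrobPIM.nakayama hτ t)
        (by rw [← map_mul, h1]) (by rw [← hαE, ← map_mul, h2]) (by rw [← hαE, ← map_mul, h3])
      rwa [← hαE, EmbeddingLike.map_eq_zero_iff, EmbeddingLike.apply_eq_iff_eq] at this
    · rw [← Submodule.Quotient.mk_eq_zero, Submodule.Quotient.mk_smul, hq, ← map_smul, hs,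
        LinearEquiv.map_eq_zero_iff]
      exact fun h => b.ne_zero (lo i) (congrArg Subtype.val h)
  · intro i i' h
    rw [hE, hE, ← map_mul]
    exact FrobPIM.map_mem_jacobson (FrobPIM.nakayama hτ).symm.toRingEquiv (horth i i' h)
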